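/- Let $\alpha,\beta\in(0,1)$ and $\lambda>0$ satisfy $\frac{\beta}{8(1-\alpha)^2}<\lambda<\frac{\beta}{2(1-\alpha)^2}$. Define the tâtonnement map $f$ on prices $p>0$ by $f(p)=p+\lambda\left[\frac{2\beta}{p}-4(1-\alpha)\right]$, put $s=\sqrt{2\lambda\beta}$, and let $E=[f(s),\,f^2(s)+s]$, where $f^k$ denotes the $k$-th iterate. Let $\mathfrak G$ be the class of continuous maps $g$ of a closed interval $[a,b]$ into itself such that (i) there is $m\in(a,b)$ with $g$ strictly decreasing on $[a,m]$ and strictly increasing on $[m,b]$, and (ii) $g(a)>a$, $g(b)<b$, and $g(x)<x$ for all $x\in[m,b)$. A continuous map $g$ of a closed interval $I$ into itself is called turbulent if there are $x_1,x_2,x_3\in I$ with $g(x_2)=g(x_1)=x_1$, $g(x_3)=x_2$, and either $x_1<x_3<x_2$ or $x_2<x_3<x_1$. An odd-period cycle is a periodic orbit whose least period is an odd number greater than $1$. Then: 1. $f$ maps $E$ into $E$, and the restriction $f|_E$ belongs to $\mathfrak G$. 2. $f$ has an odd-period cycle in $(0,\infty)$ if and only if $\frac{25\beta}{72(1-\alpha)^2}<\lambda<\frac{\beta}{2(1-\alpha)^2}$.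 3. The second iterate $(f|_E)^2$ is turbulent if and only if $\frac{25\beta}{72(1-\alpha)^2}\le\lambda<\frac{\beta}{2(1-\alpha)^2}$. -/

import Mathlib

open Set Function

noncomputable section

/-- The excess demand for good `x` at price `p > 0`. -/
def excessDemand (α β p : ℝ) : ℝ := 2 * β / p - 4 * (1 - α)

/-- The tâtonnement map with speed of adjustment `lam`; prices are the positive reals. -/
def tatonnement (α β lam p : ℝ) : ℝ := p + lam * excessDemand α β p

/-- The number `s = √(2 λ β)`. -/
def criticalPrice (β lam : ℝ) : ℝ := √(2 * lam * β)

/-- The closed interval `E = [f(s), f²(s) + s]`. -/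
abbrev priceInterval (α β lam : ℝ) : Set ℝ :=
  Icc (tatonnement α β lam (criticalPrice β lam))
    ((tatonnement α β lam)^[2] (criticalPrice β lam) + criticalPrice β lam)

/-- The class `𝔊` of Deng, Khan and Mitra: continuous self-maps of a closed interval `[a, b]`
that strictly decrease on `[a, m]` and strictly increase on `[m, b]` for some `m ∈ (a, b)`,
and satisfy `g a > a`, `g b < b` and `g x < x` for all `x ∈ [m, b)`. -/
def InClassG {a b : ℝ} (g : Icc a b → Icc a b) : Prop :=
  Continuous g ∧
  ∃ hab : a ≤ b, ∃ m : Icc a b, a < (m : ℝ) ∧ (m : ℝ) < b ∧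
    StrictAntiOn g {x | x ≤ m} ∧ StrictMonoOn g {x | m ≤ x} ∧
    a < (g ⟨a, left_mem_Icc.2 hab⟩ : ℝ) ∧ (g ⟨b, right_mem_Icc.2 hab⟩ : ℝ) < b ∧
    ∀ x : Icc a b, m ≤ x → (x : ℝ) < b → g x < x

/-- A continuous self-map `g` of a closed interval is turbulent. -/
def Turbulent {a b : ℝ} (g : Icc a b → Icc a b) : Prop :=
  Continuous g ∧
  ∃ x₁ x₂ x₃ : Icc a b, g x₂ = x₁ ∧ g x₁ = x₁ ∧ g x₃ = x₂ ∧
    ((x₁ < x₃ ∧ x₃ < x₂) ∨ (x₂ < x₃ ∧ x₃ < x₁))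

/-- `g`, regarded as a map with domain `D`, has a cycle lying in `D` whose (least) period is an
odd number greater than `1`; a fixed point does not count as an odd-period cycle. -/
def HasOddPeriodCycle (D : Set ℝ) (g : ℝ → ℝ) : Prop :=
  ∃ p : ℝ, (∀ k : ℕ, g^[k] p ∈ D) ∧ Odd (minimalPeriod g p) ∧ 1 < minimalPeriod g p

end

/-!
With the critical price `s` as unit of account, `f` becomes `g x = x + x⁻¹ - κ`, where
`κ = 4 λ (1 - α) / s`; the bounds on `λ` say `1 < κ < 2`, and `25 β / (72 (1 - α)²)` corresponds to
`κ = 5 / 3`. The critical point of `g` is `1` and its only fixed point is `κ⁻¹ = g κ`, so everything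
depends on how `g² 1`, the largest value that matters in the long run, compares with the second
preimage `κ` of the fixed point: `g² 1 - κ` has the sign of `κ - 5 / 3`.

If `g² 1 ≤ κ`, then `g` interchanges the two sides of `κ⁻¹`, so an odd iterate fixes no other point.
If `g² 1 < κ`, a turbulent triple of `g²` lies on one side of `κ⁻¹`, where `g²` is injective
or is unimodal with no fixed point on its increasing branch except `κ⁻¹`, and neither admits such a
triple. If `κ ≤ g² 1`, then `g²` takes the value `κ` on `(κ⁻¹, 1]`, which makes `κ⁻¹`, `κ` and that
point a turbulent triple. If `κ < g² 1`, then `g³ 1` lies to the right of the repelling fixed point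
`κ⁻¹`, and following the preimages of `1` back to `κ⁻¹` yields a point of odd period.
-/

/-! ### Periodic points of odd period -/

section AlternatingSets

variable {X : Type*} {g : X → X} {A B : Set X} {n : ℕ} {x : X}

theorem mapsTo_iterate_of_odd (hAB : MapsTo g A B) (hBA : MapsTo g B A) (hn : Odd n) :
    MapsTo g^[n] A B := by
  obtain ⟨k, rfl⟩ := hn
  rw [add_comm, iterate_add, iterate_mul]
  exact hAB.comp (MapsTo.iterate (hBA.comp hAB) k)

theorem mem_inter_of_isPeriodicPt_odd (hAB : MapsTo g A B) (hBA : MapsTo g B A) (hn : Odd n)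
    (hper : IsPeriodicPt g n x) (hx : x ∈ A ∪ B) : x ∈ A ∩ B := by
  rcases hx with hA | hB
  · exact ⟨hA, hper.eq ▸ mapsTo_iterate_of_odd hAB hBA hn hA⟩
  · exact ⟨hper.eq ▸ mapsTo_iterate_of_odd hBA hAB hn hB, hB⟩

end AlternatingSets

section AbsorbingBound

variable {X : Type*} [LinearOrder X] {f g : X → X} {D : Set X} {c d x : X} {n : ℕ}

/-- `c` is an absorbing upper bound for the self-map `g` of `D`: no point of `D` below `c` is moved
above `c`, and every point of `D` above `c` is moved down. It confines periodic points and
turbulent triples of `g` to the part of `D` below `c`. -/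
structure IsAbsorbingBound (g : X → X) (D : Set X) (c : X) : Prop where
  mapsTo : MapsTo g D D
  apply_le : ∀ x ∈ D, x ≤ c → g x ≤ c
  apply_lt_self : ∀ x ∈ D, c < x → g x < x

namespace IsAbsorbingBound

theorem apply_lt (h : IsAbsorbingBound g D c) (hx : x ∈ D) (hcd : c < d) (hxd : x < d) :
    g x < d := by
  rcases le_or_gt x c with hxc | hcx
  · exact (h.apply_le x hx hxc).trans_lt hcd
  · exact (h.apply_lt_self x hx hcx).trans hxd

theorem comp (hf : IsAbsorbingBound f D c) (hg : IsAbsorbingBound g D c) :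
    IsAbsorbingBound (f ∘ g) D c where
  mapsTo := hf.mapsTo.comp hg.mapsTo
  apply_le x hx hxc := hf.apply_le _ (hg.mapsTo hx) (hg.apply_le x hx hxc)
  apply_lt_self x hx hcx := hf.apply_lt (hg.mapsTo hx) hcx (hg.apply_lt_self x hx hcx)

theorem le_of_isPeriodicPt (h : IsAbsorbingBound g D c) (hx : x ∈ D) (hn : 0 < n)
    (hper : IsPeriodicPt g n x) : x ≤ c := by
  by_contra! hcx
  obtain ⟨k, rfl⟩ := Nat.exists_eq_add_one.2 hn
  have hmap : MapsTo g (D ∩ Iio x) (D ∩ Iio x) := fun y hy =>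
    ⟨h.mapsTo hy.1, h.apply_lt hy.1 hcx hy.2⟩
  have hlt := (hmap.iterate k ⟨h.mapsTo hx, h.apply_lt_self x hx hcx⟩).2
  exact hlt.ne hper.eq

end IsAbsorbingBound

end AbsorbingBound

section OddPeriod

variable {X : Type*} [ConditionallyCompleteLinearOrder X] [DenselyOrdered X] [TopologicalSpace X]
  [OrderTopology X] {g φ : X → X} {D : Set X} {z m t : X}

theorem exists_lt_iterate_eq_of_lt_apply (hzm : z < m) (hzt : z < t)
    (hφ : ContinuousOn φ (Icc z m)) (hz : φ z = z) (hlt : ∀ x ∈ Ioc z m, x < φ x) :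
    ∃ y ∈ Ioc z m, y < t ∧ ∃ k, φ^[k] y = m := by
  let S := {y ∈ Ioc z m | ∃ k, φ^[k] y = m}
  have hne : S.Nonempty := ⟨m, ⟨hzm, le_rfl⟩, 0, rfl⟩
  have hbdd : BddBelow S := ⟨z, fun y hy => hy.1.1.le⟩
  have hinf : sInf S ≤ z := by
    by_contra! hzL
    have hLm : sInf S ≤ m := csInf_le hbdd ⟨⟨hzm, le_rfl⟩, 0, rfl⟩
    obtain ⟨y, ⟨hy, k, hk⟩, hyL⟩ := exists_lt_of_csInf_lt hne (hlt _ ⟨hzL, hLm⟩)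
    obtain ⟨x, hx, rfl⟩ := intermediate_value_Ioo hzL.le (hφ.mono (Icc_subset_Icc_right hLm))
      ⟨hz.trans_lt hy.1, hyL⟩
    exact (csInf_le hbdd ⟨⟨hx.1, hx.2.le.trans hLm⟩, k + 1, hk⟩).not_gt hx.2
  obtain ⟨y, ⟨hy, hk⟩, hyt⟩ := exists_lt_of_csInf_lt hne (hinf.trans_lt hzt)
  exact ⟨y, hy, hyt, hk⟩

/- A point `y` close to `z` reaches `m` under `g²`, and so does its `g²`-preimage `x ∈ (z, y)`, one
step later. With `k` such steps for `y`, the map `g^[2 * k + 3]` sends `y` to `g³ m ≥ y` and `x` to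
`g m ≤ x`, so it has a fixed point in between. -/
theorem exists_isPeriodicPt_odd (hg : ContinuousOn g D) (hD : MapsTo g D D) (hzm : z < m)
    (hzmD : Icc z m ⊆ D) (hz : g z = z) (hlt : ∀ x ∈ Ioc z m, x < g^[2] x) (hm : g m ≤ z)
    (hm₃ : z < g^[3] m) : ∃ p ∈ Ioc z m, ∃ n, Odd n ∧ IsPeriodicPt g n p := by
  have hg₂ : ContinuousOn g^[2] (Icc z m) := (hg.iterate hD 2).mono hzmD
  have hz₂ : g^[2] z = z := iterate_fixed hz 2
  obtain ⟨y, hy, hyt, k, hk⟩ := exists_lt_iterate_eq_of_lt_apply hzm hm₃ hg₂ hz₂ hlt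
  obtain ⟨x, hx, rfl⟩ := intermediate_value_Ioo hy.1.le (hg₂.mono (Icc_subset_Icc_right hy.2))
    ⟨hz₂.trans_lt hy.1, hlt y hy⟩
  have hxm : Icc x (g^[2] x) ⊆ Icc z m := Icc_subset_Icc hx.1.le hy.2
  rw [← iterate_mul] at hk
  have hx' : g^[3 + 2 * k] x ≤ x := by
    rw [show 3 + 2 * k = 1 + 2 * k + 2 by ring, iterate_add_apply, iterate_add_apply, hk]
    exact hm.trans hx.1.le
  have hy' : g^[2] x ≤ g^[3 + 2 * k] (g^[2] x) := by
    rw [iterate_add_apply, hk]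
    exact hyt.le
  obtain ⟨p, hp, hper⟩ := isPreconnected_Icc.intermediate_value₂ (left_mem_Icc.2 hx.2.le)
    (right_mem_Icc.2 hx.2.le) ((hg.iterate hD _).mono (hxm.trans hzmD)) continuousOn_id hx' hy'
  exact ⟨p, ⟨hx.1.trans_le hp.1, hp.2.trans hy.2⟩, _, ⟨k + 1, by ring⟩, hper⟩

end OddPeriod

theorem hasOddPeriodCycle_iff_exists_isPeriodicPt {D : Set ℝ} {g : ℝ → ℝ} (hD : MapsTo g D D) :
    HasOddPeriodCycle D g ↔ ∃ p ∈ D, g p ≠ p ∧ ∃ n, Odd n ∧ IsPeriodicPt g n p := by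
  constructor
  · rintro ⟨p, hp, hodd, hgt⟩
    refine ⟨p, hp 0, fun hfix => ?_, _, hodd, isPeriodicPt_minimalPeriod g p⟩
    exact hgt.ne' (minimalPeriod_eq_one_iff_isFixedPt.2 hfix)
  · rintro ⟨p, hp, hne, n, hn, hper⟩
    refine ⟨p, fun k => hD.iterate k hp, hn.of_dvd_nat hper.minimalPeriod_dvd, ?_⟩
    refine (Nat.one_le_iff_ne_zero.2 (hper.minimalPeriod_pos hn.pos).ne').lt_of_ne' fun h => ?_
    exact hne (minimalPeriod_eq_one_iff_isFixedPt.1 h)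

/-! ### Turbulence and conjugacy -/

section TurbulentTriple

variable {X Y : Type*} [LinearOrder X] [LinearOrder Y] {g : X → X} {x₁ x₂ x₃ : X}

/-- The triples `x₁, x₂, x₃` whose existence makes a continuous self-map `g` turbulent. -/
structure IsTurbulentTriple (g : X → X) (x₁ x₂ x₃ : X) : Prop where
  apply_fst : g x₁ = x₁
  apply_snd : g x₂ = x₁
  apply_thd : g x₃ = x₂
  between : (x₁ < x₃ ∧ x₃ < x₂) ∨ (x₂ < x₃ ∧ x₃ < x₁)

theorem turbulent_iff_exists_isTurbulentTriple {a b : ℝ} {g : Icc a b → Icc a b} :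
    Turbulent g ↔ Continuous g ∧ ∃ x₁ x₂ x₃, IsTurbulentTriple g x₁ x₂ x₃ :=
  and_congr_right fun _ => exists₃_congr fun _ _ _ =>
    ⟨fun ⟨h₂, h₁, h₃, h⟩ => ⟨h₁, h₂, h₃, h⟩, fun ⟨h₁, h₂, h₃, h⟩ => ⟨h₂, h₁, h₃, h⟩⟩

theorem isTurbulentTriple_map_iff {σ : X → Y} {f : Y → Y} (hσ : StrictMono σ)
    (h : Semiconj σ g f) :
    IsTurbulentTriple f (σ x₁) (σ x₂) (σ x₃) ↔ IsTurbulentTriple g x₁ x₂ x₃ := by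
  constructor <;> rintro ⟨h₁, h₂, h₃, hb⟩
  · simp only [← h.eq, hσ.injective.eq_iff, hσ.lt_iff_lt] at h₁ h₂ h₃ hb
    exact ⟨h₁, h₂, h₃, hb⟩
  · constructor <;> simpa only [← h.eq, hσ.injective.eq_iff, hσ.lt_iff_lt]

namespace IsTurbulentTriple

theorem fst_ne_snd (h : IsTurbulentTriple g x₁ x₂ x₃) : x₁ ≠ x₂ := by
  rcases h.between with ⟨h₁₃, h₃₂⟩ | ⟨h₂₃, h₃₁⟩
  · exact (h₁₃.trans h₃₂).ne
  · exact (h₂₃.trans h₃₁).ne'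

theorem map_strictAntiOn {σ : X → X} {s : Set X} (h : IsTurbulentTriple g x₁ x₂ x₃)
    (hσ : StrictAntiOn σ s) (hcomm : Function.Commute σ g) (h₁ : x₁ ∈ s) (h₂ : x₂ ∈ s)
    (h₃ : x₃ ∈ s) : IsTurbulentTriple g (σ x₁) (σ x₂) (σ x₃) where
  apply_fst := by rw [← hcomm.eq, h.apply_fst]
  apply_snd := by rw [← hcomm.eq, h.apply_snd]
  apply_thd := by rw [← hcomm.eq, h.apply_thd]
  between := h.between.symm.imp (fun hb => ⟨hσ h₃ h₁ hb.2, hσ h₂ h₃ hb.1⟩)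
    fun hb => ⟨hσ h₃ h₂ hb.2, hσ h₁ h₃ hb.1⟩

theorem le_of_isAbsorbingBound {D : Set X} {c : X} (h : IsTurbulentTriple g x₁ x₂ x₃)
    (hc : IsAbsorbingBound g D c) (h₁ : x₁ ∈ D) (h₃ : x₃ ∈ D) : x₁ ≤ c ∧ x₂ ≤ c ∧ x₃ ≤ c := by
  have hx₁ : x₁ ≤ c := not_lt.1 fun hx => (hc.apply_lt_self x₁ h₁ hx).ne h.apply_fst
  rcases h.between with ⟨-, h₃₂⟩ | ⟨h₂₃, h₃₁⟩
  · have hx₂ : x₂ ≤ c := not_lt.1 fun hx => (hc.apply_lt h₃ hx h₃₂).ne h.apply_thd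
    exact ⟨hx₁, hx₂, h₃₂.le.trans hx₂⟩
  · exact ⟨hx₁, (h₂₃.trans h₃₁).le.trans hx₁, h₃₁.le.trans hx₁⟩

theorem fst_lt_of_unimodal {l m r : X} (h : IsTurbulentTriple g x₁ x₂ x₃)
    (hmono : StrictMonoOn g (Icc l m)) (hanti : StrictAntiOn g (Icc m r)) (h₁ : x₁ ∈ Icc l r)
    (h₂ : x₂ ∈ Icc l r) (h₃ : x₃ ∈ Icc l r) : x₁ < x₂ ∧ x₁ < m := by
  have h₁₂ : x₁ < x₂ := by
    refine h.fst_ne_snd.lt_or_gt.resolve_right fun h₂₁ => ?_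
    obtain ⟨h₂₃, h₃₁⟩ := h.between.resolve_left fun hb => (hb.1.trans hb.2).asymm h₂₁
    rcases le_total x₃ m with h₃m | hm₃
    · have hlt := hmono ⟨h₂.1, h₂₃.le.trans h₃m⟩ ⟨h₃.1, h₃m⟩ h₂₃
      rw [h.apply_snd, h.apply_thd] at hlt
      exact hlt.asymm h₂₁
    · have hlt := hanti ⟨hm₃, h₃.2⟩ ⟨hm₃.trans h₃₁.le, h₁.2⟩ h₃₁
      rw [h.apply_fst, h.apply_thd] at hlt
      exact hlt.asymm h₂₁
  refine ⟨h₁₂, not_le.1 fun hm₁ => ?_⟩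
  have hlt := hanti ⟨hm₁, h₁.2⟩ ⟨hm₁.trans h₁₂.le, h₂.2⟩ h₁₂
  exact hlt.ne (h.apply_snd.trans h.apply_fst.symm)

end IsTurbulentTriple

end TurbulentTriple

section Conjugacy

theorem continuous_of_semiconj {X Y : Type*} [TopologicalSpace X] [TopologicalSpace Y] {g : X → X}
    {f : Y → Y} (e : X ≃ₜ Y) (h : Semiconj e g f) (hg : Continuous g) : Continuous f := by
  rwa [← e.comp_continuous_iff', ← h.comp_eq, e.comp_continuous_iff]

variable {a b c d : ℝ} {g : Icc a b → Icc a b} {f : Icc c d → Icc c d}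

theorem InClassG.of_semiconj (E : Icc a b ≃o Icc c d) (h : Semiconj E g f) (hg : InClassG g) :
    InClassG f := by
  obtain ⟨hcont, hab, m, ham, hmb, hanti, hmono, hga, hgb, hlt⟩ := hg
  have hcd : c ≤ d := (E m).2.1.trans (E m).2.2
  have hEa : E ⟨a, left_mem_Icc.2 hab⟩ = ⟨c, left_mem_Icc.2 hcd⟩ :=
    le_antisymm (E.le_symm_apply.1 (E.symm _).2.1) (E _).2.1
  have hEb : E ⟨b, right_mem_Icc.2 hab⟩ = ⟨d, right_mem_Icc.2 hcd⟩ :=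
    le_antisymm (E _).2.2 (E.symm_apply_le.1 (E.symm _).2.2)
  have lt_map {x : Icc a b} : c < E x ↔ a < x := by
    have hlt := E.lt_iff_lt (x := ⟨a, left_mem_Icc.2 hab⟩) (y := x)
    rwa [hEa] at hlt
  have map_lt {x : Icc a b} : E x < d ↔ x < b := by
    have hlt := E.lt_iff_lt (x := x) (y := ⟨b, right_mem_Icc.2 hab⟩)
    rwa [hEb] at hlt
  refine ⟨continuous_of_semiconj E.toHomeomorph h hcont, hcd, E m, lt_map.2 ham, map_lt.2 hmb,
    ?_, ?_, ?_, ?_, ?_⟩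
  · intro x hx y hy hxy
    obtain ⟨x, rfl⟩ := E.surjective x
    obtain ⟨y, rfl⟩ := E.surjective y
    rw [← h.eq, ← h.eq]
    exact E.strictMono (hanti (E.le_iff_le.1 hx) (E.le_iff_le.1 hy) (E.lt_iff_lt.1 hxy))
  · intro x hx y hy hxy
    obtain ⟨x, rfl⟩ := E.surjective x
    obtain ⟨y, rfl⟩ := E.surjective y
    rw [← h.eq, ← h.eq]
    exact E.strictMono (hmono (E.le_iff_le.1 hx) (E.le_iff_le.1 hy) (E.lt_iff_lt.1 hxy))
  · rw [← hEa, ← h.eq]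
    exact lt_map.2 hga
  · rw [← hEb, ← h.eq]
    exact map_lt.2 hgb
  · intro y hmy hyd
    obtain ⟨x, rfl⟩ := E.surjective y
    rw [← h.eq]
    exact E.strictMono (hlt x (E.le_iff_le.1 hmy) (map_lt.1 hyd))

theorem turbulent_iterate_iff_of_semiconj (E : Icc a b ≃o Icc c d) (h : Semiconj E g f) (n : ℕ) :
    Turbulent f^[n] ↔ Turbulent g^[n] := by
  have hn := h.iterate_right n
  simp only [turbulent_iff_exists_isTurbulentTriple]
  have hn' : Semiconj E.symm f^[n] g^[n] := hn.inverse_left E.left_inv E.right_inv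
  refine and_congr ⟨continuous_of_semiconj E.symm.toHomeomorph hn',
    continuous_of_semiconj E.toHomeomorph hn⟩ ?_
  simp only [E.surjective.exists, isTurbulentTriple_map_iff E.strictMono hn]

theorem hasOddPeriodCycle_iff_of_semiconj {D : Set ℝ} {f g : ℝ → ℝ} (e : ℝ ≃ ℝ)
    (h : Semiconj e g f) : HasOddPeriodCycle D f ↔ HasOddPeriodCycle (e ⁻¹' D) g := by
  have hper (x : ℝ) : minimalPeriod f (e x) = minimalPeriod g x :=
    minimalPeriod_eq_minimalPeriod_iff.2 fun n => by
      rw [IsPeriodicPt, IsPeriodicPt, IsFixedPt, IsFixedPt, ← (h.iterate_right n).eq,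
        e.injective.eq_iff]
  unfold HasOddPeriodCycle
  rw [e.surjective.exists]
  simp only [hper, mem_preimage, fun k => (h.iterate_right k).eq]

end Conjugacy

/-! ### The tâtonnement map in scaled prices -/

/-- The tâtonnement map in the unit of account in which its critical price is `1`, with the single
remaining parameter `κ`. -/
noncomputable def scaledMap (κ x : ℝ) : ℝ := x + x⁻¹ - κ

namespace scaledMap

variable {κ x y : ℝ}

theorem sub_apply (hx : 0 < x) (hy : 0 < y) :
    scaledMap κ y - scaledMap κ x = (y - x) * (x * y - 1) / (x * y) := by
  unfold scaledMap
  field_simp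
  ring

theorem lt_of_one_lt_mul (hx : 0 < x) (hxy : x < y) (h : 1 < x * y) :
    scaledMap κ x < scaledMap κ y := by
  have hy := hx.trans hxy
  rw [← sub_pos, sub_apply hx hy]
  exact div_pos (mul_pos (sub_pos.2 hxy) (sub_pos.2 h)) (mul_pos hx hy)

theorem le_of_mul_le_one (hx : 0 < x) (hxy : x ≤ y) (h : x * y ≤ 1) :
    scaledMap κ y ≤ scaledMap κ x := by
  have hy := hx.trans_le hxy
  rw [← sub_nonpos, sub_apply hx hy]
  exact div_nonpos_of_nonpos_of_nonneg
    (mul_nonpos_of_nonneg_of_nonpos (sub_nonneg.2 hxy) (sub_nonpos.2 h)) (mul_pos hx hy).le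

theorem lt_of_mul_lt_one (hx : 0 < x) (hxy : x < y) (h : x * y < 1) :
    scaledMap κ y < scaledMap κ x := by
  have hy := hx.trans hxy
  rw [← sub_neg, sub_apply hx hy]
  exact div_neg_of_neg_of_pos (mul_neg_of_pos_of_neg (sub_pos.2 hxy) (sub_neg.2 h)) (mul_pos hx hy)

theorem strictAntiOn : StrictAntiOn (scaledMap κ) (Ioc 0 1) := fun _ hx _ hy hxy =>
  lt_of_mul_lt_one hx.1 hxy (mul_lt_one_of_nonneg_of_lt_one_left hx.1.le (hxy.trans_le hy.2) hy.2)

theorem strictMonoOn : StrictMonoOn (scaledMap κ) (Ici 1) := fun _ hx _ _ hxy =>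
  lt_of_one_lt_mul (zero_lt_one.trans_le hx) hxy
    (one_lt_mul_of_le_of_lt hx (lt_of_le_of_lt hx hxy))

theorem apply_one : scaledMap κ 1 = 2 - κ := by
  unfold scaledMap
  norm_num

theorem two_sub_le (hx : 0 < x) : 2 - κ ≤ scaledMap κ x := by
  rw [← apply_one]
  rcases le_total x 1 with h | h
  · exact strictAntiOn.antitoneOn ⟨hx, h⟩ ⟨one_pos, le_rfl⟩ h
  · exact strictMonoOn.monotoneOn self_mem_Ici h h

theorem pos (hκ : κ < 2) (hx : 0 < x) : 0 < scaledMap κ x :=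
  (sub_pos.2 hκ).trans_le (two_sub_le hx)

theorem mapsTo_pos (hκ : κ < 2) : MapsTo (scaledMap κ) (Ioi 0) (Ioi 0) := fun _ hx => pos hκ hx

theorem continuousOn : ContinuousOn (scaledMap κ) (Ioi 0) :=
  (continuousOn_id.add (continuousOn_id.inv₀ fun _ hx => ne_of_gt hx)).sub continuousOn_const

theorem apply_inv : scaledMap κ κ⁻¹ = κ⁻¹ := by
  simp [scaledMap]

theorem apply_self : scaledMap κ κ = κ⁻¹ := by
  simp [scaledMap]

theorem lt_self (hκ : 0 < κ) (hx : κ⁻¹ < x) : scaledMap κ x < x := by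
  have hinv : x⁻¹ < κ := inv_lt_of_inv_lt₀ hκ hx
  unfold scaledMap
  linarith

theorem two_sub_lt_inv (h1 : 1 < κ) : 2 - κ < κ⁻¹ := by
  have h : κ⁻¹ - (2 - κ) = (κ - 1) ^ 2 / κ := by
    field_simp
    ring
  have : 0 < (κ - 1) ^ 2 / κ := div_pos (pow_pos (sub_pos.2 h1) 2) (one_pos.trans h1)
  linarith

theorem inv_lt_apply_two_sub (h1 : 1 < κ) (hκ : κ < 2) : κ⁻¹ < scaledMap κ (2 - κ) := by
  have hlt := strictAntiOn (κ := κ) ⟨sub_pos.2 hκ, by linarith⟩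
    ⟨inv_pos.2 (by linarith), (inv_lt_one_of_one_lt₀ h1).le⟩ (two_sub_lt_inv h1)
  rwa [apply_inv] at hlt

theorem one_lt_apply_two_sub_iff (h1 : 1 < κ) (hκ : κ < 2) :
    1 < scaledMap κ (2 - κ) ↔ 3 / 2 < κ := by
  have h2 : 0 < 2 - κ := sub_pos.2 hκ
  have h : scaledMap κ (2 - κ) - 1 = 2 * (κ - 3 / 2) * (κ - 1) / (2 - κ) := by
    unfold scaledMap
    field_simp
    ring
  rw [← sub_pos, h, div_pos_iff_of_pos_right h2, mul_pos_iff_of_pos_right (sub_pos.2 h1),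
    mul_pos_iff_of_pos_left two_pos, sub_pos]

theorem apply_two_sub_sub_self (hκ : κ < 2) :
    scaledMap κ (2 - κ) - κ = (κ - 5 / 3) * (3 * (κ - 1) / (2 - κ)) := by
  have h2 : 0 < 2 - κ := sub_pos.2 hκ
  unfold scaledMap
  field_simp
  ring

theorem lt_apply_two_sub_iff (h1 : 1 < κ) (hκ : κ < 2) :
    κ < scaledMap κ (2 - κ) ↔ 5 / 3 < κ := by
  have h : 0 < 3 * (κ - 1) / (2 - κ) := div_pos (by linarith) (by linarith)
  rw [← sub_pos, apply_two_sub_sub_self hκ, mul_pos_iff_of_pos_right h, sub_pos]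

theorem le_apply_two_sub_iff (h1 : 1 < κ) (hκ : κ < 2) :
    κ ≤ scaledMap κ (2 - κ) ↔ 5 / 3 ≤ κ := by
  have h : 0 < 3 * (κ - 1) / (2 - κ) := div_pos (by linarith) (by linarith)
  rw [← sub_nonneg, apply_two_sub_sub_self hκ, mul_nonneg_iff_of_pos_right h, sub_nonneg]

theorem isAbsorbingBound (h1 : 1 < κ) (hκ : κ < 2) :
    IsAbsorbingBound (scaledMap κ) (Ici (2 - κ)) (scaledMap κ (2 - κ)) where
  mapsTo x hx := two_sub_le ((sub_pos.2 hκ).trans_le hx)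
  apply_le x hx hxc := by
    rcases le_or_gt ((2 - κ) * x) 1 with h | h
    · exact le_of_mul_le_one (sub_pos.2 hκ) hx h
    · have hinv : κ⁻¹ < x := by
        rw [inv_lt_iff_one_lt_mul₀' (by linarith)]
        exact h.trans_le (mul_le_mul_of_nonneg_right (by linarith) (by linarith [mem_Ici.1 hx]))
      exact (lt_self (by linarith) hinv).le.trans hxc
  apply_lt_self x _ hcx := lt_self (by linarith) ((inv_lt_apply_two_sub h1 hκ).trans hcx)

theorem Icc_two_sub_inv_subset (h1 : 1 < κ) (hκ : κ < 2) : Icc (2 - κ) κ⁻¹ ⊆ Ioc 0 1 :=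
  Icc_subset_Ioc (sub_pos.2 hκ) (inv_lt_one_of_one_lt₀ h1).le

theorem mapsTo_Icc_two_sub_inv (h1 : 1 < κ) (hκ : κ < 2) :
    MapsTo (scaledMap κ) (Icc (2 - κ) κ⁻¹) (Icc κ⁻¹ (scaledMap κ (2 - κ))) := by
  have hanti := strictAntiOn (κ := κ).antitoneOn.mono (Icc_two_sub_inv_subset h1 hκ)
  have hmap := hanti.mapsTo_Icc
  rwa [apply_inv] at hmap

theorem mapsTo_Icc_inv_self (h1 : 1 < κ) :
    MapsTo (scaledMap κ) (Icc κ⁻¹ κ) (Icc (2 - κ) κ⁻¹) := by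
  have h0 : 0 < κ := one_pos.trans h1
  intro x hx
  have hle : scaledMap κ x ≤ scaledMap κ κ⁻¹ :=
    le_of_mul_le_one (inv_pos.2 h0) hx.1 ((inv_mul_le_one₀ h0).2 hx.2)
  exact ⟨two_sub_le ((inv_pos.2 h0).trans_le hx.1), apply_inv (κ := κ) ▸ hle⟩

theorem mapsTo_Icc_inv_self_Ioc (h1 : 1 < κ) (hκ : κ < 2) :
    MapsTo (scaledMap κ) (Icc κ⁻¹ κ) (Ioc 0 1) :=
  (mapsTo_Icc_inv_self h1).mono_right (Icc_two_sub_inv_subset h1 hκ)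

theorem strictMonoOn_iterate_two (h1 : 1 < κ) (hκ : κ < 2) :
    StrictMonoOn (scaledMap κ)^[2] (Icc κ⁻¹ 1) := by
  have hinv : 0 < κ⁻¹ := inv_pos.2 (one_pos.trans h1)
  exact strictAntiOn.comp (strictAntiOn.mono (Icc_subset_Ioc hinv le_rfl))
    ((mapsTo_Icc_inv_self_Ioc h1 hκ).mono_left (Icc_subset_Icc_right h1.le))

theorem strictAntiOn_iterate_two (h1 : 1 < κ) (hκ : κ < 2) :
    StrictAntiOn (scaledMap κ)^[2] (Icc 1 κ) := by
  have hinv : κ⁻¹ ≤ 1 := (inv_lt_one_of_one_lt₀ h1).le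
  exact strictAntiOn.comp_strictMonoOn (strictMonoOn.mono Icc_subset_Ici_self)
    ((mapsTo_Icc_inv_self_Ioc h1 hκ).mono_left (Icc_subset_Icc_left hinv))

theorem iterate_two_sub_self (hκ : κ < 2) (hx : 0 < x) :
    (scaledMap κ)^[2] x - x =
      (κ * x - 1) * ((2 * x - 1) * (1 - x) + (2 * κ - 3) * x) / (x ^ 2 * scaledMap κ x) := by
  have hpos := pos hκ hx
  have hs : x * scaledMap κ x = x ^ 2 + 1 - κ * x := by
    unfold scaledMap
    field_simp
  have e : (scaledMap κ)^[2] x = scaledMap κ x + (scaledMap κ x)⁻¹ - κ := rfl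
  rw [e]
  generalize scaledMap κ x = u at *
  field_simp
  linear_combination (x * u + 1 - 2 * κ * x) * hs

theorem lt_iterate_two (h1 : 3 / 2 < κ) (hκ : κ < 2) (hx : x ∈ Ioc κ⁻¹ 1) :
    x < (scaledMap κ)^[2] x := by
  have h0 : 0 < κ := by linarith
  have hx0 : 0 < x := (inv_pos.2 h0).trans hx.1
  have hκx : 0 < κ * x - 1 := sub_pos.2 ((inv_lt_iff_one_lt_mul₀' h0).1 hx.1)
  have h2x : 0 < 2 * x - 1 := hκx.trans (by nlinarith)
  have hquad : 0 < (2 * x - 1) * (1 - x) + (2 * κ - 3) * x :=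
    add_pos_of_nonneg_of_pos (mul_nonneg h2x.le (sub_nonneg.2 hx.2))
      (mul_pos (by linarith) hx0)
  rw [← sub_pos, iterate_two_sub_self hκ hx0]
  exact div_pos (mul_pos hκx hquad) (mul_pos (pow_pos hx0 2) (pos hκ hx0))

theorem inv_lt_iterate_two (h1 : 1 < κ) (hκ : κ < 2) (hx : x ∈ Ioo κ⁻¹ κ) :
    κ⁻¹ < (scaledMap κ)^[2] x := by
  have h0 : 0 < κ := one_pos.trans h1
  have hinv : 0 < κ⁻¹ := inv_pos.2 h0
  have hlt : scaledMap κ x < κ⁻¹ := by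
    have h := lt_of_mul_lt_one (κ := κ) hinv hx.1 ((inv_mul_lt_one₀ h0).2 hx.2)
    rwa [apply_inv] at h
  have hone : κ⁻¹ ≤ 1 := (inv_lt_one_of_one_lt₀ h1).le
  have h := strictAntiOn (κ := κ) ⟨pos hκ (hinv.trans hx.1), hlt.le.trans hone⟩ ⟨hinv, hone⟩ hlt
  rwa [apply_inv] at h

theorem not_isTurbulentTriple_iterate_two_of_mem_Ico {x₁ x₂ x₃ : ℝ} (h1 : 3 / 2 < κ) (hκ : κ < 2)
    (hx₁ : x₁ ∈ Ico κ⁻¹ κ) (hx₂ : x₂ ∈ Ico κ⁻¹ κ) (hx₃ : x₃ ∈ Ico κ⁻¹ κ) :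
    ¬IsTurbulentTriple (scaledMap κ)^[2] x₁ x₂ x₃ := by
  intro h
  have h1' : 1 < κ := by linarith
  obtain ⟨h₁₂, hlt⟩ := h.fst_lt_of_unimodal (strictMonoOn_iterate_two h1' hκ)
    (strictAntiOn_iterate_two h1' hκ) (Ico_subset_Icc_self hx₁) (Ico_subset_Icc_self hx₂)
    (Ico_subset_Icc_self hx₃)
  rcases hx₁.1.eq_or_lt with rfl | hinv
  · exact (inv_lt_iterate_two h1' hκ ⟨h₁₂, hx₂.2⟩).ne' h.apply_snd
  · exact (lt_iterate_two h1 hκ ⟨hinv, hlt.le⟩).ne' h.apply_fst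

theorem injOn_iterate_two (h1 : 1 < κ) (hκ : κ ≤ 3 / 2) :
    InjOn (scaledMap κ)^[2] (Icc (2 - κ) (scaledMap κ (2 - κ))) := by
  have hκ2 : κ < 2 := by linarith
  have hbound := isAbsorbingBound h1 hκ2
  have htop : scaledMap κ (2 - κ) ≤ 1 :=
    not_lt.1 fun h => hκ.not_gt ((one_lt_apply_two_sub_iff h1 hκ2).1 h)
  have hmap : MapsTo (scaledMap κ) (Icc (2 - κ) (scaledMap κ (2 - κ)))
      (Icc (2 - κ) (scaledMap κ (2 - κ))) :=
    fun x hx => ⟨hbound.mapsTo hx.1, hbound.apply_le x hx.1 hx.2⟩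
  exact (strictAntiOn.injOn.mono (Icc_subset_Ioc (sub_pos.2 hκ2) htop)).iterate hmap 2

/- Below `5 / 3` the map interchanges the two sides of its fixed point `κ⁻¹`, so a turbulent triple
of the second iterate lies on one side; one on the left is carried to the right by the map. -/
theorem five_thirds_le_of_isTurbulentTriple {x₁ x₂ x₃ : ℝ} (h1 : 1 < κ) (hκ : κ < 2)
    (hx₁ : 2 - κ ≤ x₁) (hx₂ : 2 - κ ≤ x₂) (hx₃ : 2 - κ ≤ x₃)
    (h : IsTurbulentTriple (scaledMap κ)^[2] x₁ x₂ x₃) : 5 / 3 ≤ κ := by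
  by_contra! hκ'
  have hbound := isAbsorbingBound h1 hκ
  obtain ⟨hc₁, hc₂, hc₃⟩ := h.le_of_isAbsorbingBound (hbound.comp hbound) hx₁ hx₃
  rcases le_or_gt κ (3 / 2) with hle | hgt
  · exact h.fst_ne_snd
      (injOn_iterate_two h1 hle ⟨hx₁, hc₁⟩ ⟨hx₂, hc₂⟩ (h.apply_fst.trans h.apply_snd.symm))
  have htop : scaledMap κ (2 - κ) < κ :=
    not_le.1 fun hle => hκ'.not_ge ((le_apply_two_sub_iff h1 hκ).1 hle)
  set A := Icc (2 - κ) κ⁻¹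
  set B := Icc κ⁻¹ (scaledMap κ (2 - κ))
  have hBκ : B ⊆ Ico κ⁻¹ κ := Icc_subset_Ico_right htop
  have hAB : MapsTo (scaledMap κ) A B := mapsTo_Icc_two_sub_inv h1 hκ
  have hBA : MapsTo (scaledMap κ) B A :=
    (mapsTo_Icc_inv_self h1).mono_left (Icc_subset_Icc_right htop.le)
  have hB {y₁ y₂ y₃ : ℝ} (hy : IsTurbulentTriple (scaledMap κ)^[2] y₁ y₂ y₃) (h₁ : y₁ ∈ B)
      (h₂ : y₂ ∈ B) (h₃ : y₃ ∈ B) : False :=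
    not_isTurbulentTriple_iterate_two_of_mem_Ico hgt hκ (hBκ h₁) (hBκ h₂) (hBκ h₃) hy
  rcases le_total x₃ κ⁻¹ with hleft | hright
  · have h₃ : x₃ ∈ A := ⟨hx₃, hleft⟩
    have h₂ : x₂ ∈ A := h.apply_thd ▸ hBA (hAB h₃)
    have h₁ : x₁ ∈ A := h.apply_snd ▸ hBA (hAB h₂)
    have hanti : StrictAntiOn (scaledMap κ) A := strictAntiOn.mono (Icc_two_sub_inv_subset h1 hκ)
    exact hB (h.map_strictAntiOn hanti (Function.Commute.self_iterate _ 2) h₁ h₂ h₃)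
      (hAB h₁) (hAB h₂) (hAB h₃)
  · have h₃ : x₃ ∈ B := ⟨hright, hc₃⟩
    have h₂ : x₂ ∈ B := h.apply_thd ▸ hAB (hBA h₃)
    have h₁ : x₁ ∈ B := h.apply_snd ▸ hAB (hBA h₂)
    exact hB h h₁ h₂ h₃

theorem exists_iterate_two_eq (h1 : 5 / 3 ≤ κ) (hκ : κ < 2) :
    ∃ x ∈ Ioc κ⁻¹ 1, (scaledMap κ)^[2] x = κ := by
  have h1' : 1 < κ := by linarith
  have hinv : 0 < κ⁻¹ := inv_pos.2 (by linarith)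
  have hcont : ContinuousOn (scaledMap κ)^[2] (Icc κ⁻¹ 1) :=
    (continuousOn.iterate (mapsTo_pos hκ) 2).mono fun x hx => hinv.trans_le hx.1
  refine intermediate_value_Ioc (inv_lt_one_of_one_lt₀ h1').le hcont ⟨?_, ?_⟩
  · rw [iterate_fixed apply_inv]
    exact (inv_lt_one_of_one_lt₀ h1').trans h1'
  · rw [iterate_succ_apply, apply_one]
    exact (le_apply_two_sub_iff h1' hκ).2 h1

theorem exists_isTurbulentTriple_iterate_two (h1 : 5 / 3 ≤ κ) (hκ : κ < 2) :
    ∃ x ∈ Ioc κ⁻¹ 1, IsTurbulentTriple (scaledMap κ)^[2] κ⁻¹ κ x := by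
  have h1' : 1 < κ := by linarith
  obtain ⟨x, hx, hxκ⟩ := exists_iterate_two_eq h1 hκ
  have hfix : (scaledMap κ)^[2] κ⁻¹ = κ⁻¹ := iterate_fixed apply_inv 2
  have hκfix : (scaledMap κ)^[2] κ = κ⁻¹ := by
    rw [iterate_succ_apply, apply_self]
    exact apply_inv
  exact ⟨x, hx, hfix, hκfix, hxκ, Or.inl ⟨hx.1, hx.2.trans_lt h1'⟩⟩

/-- The interval `E` of the theorem in scaled prices; it contains the critical point `1`. -/
abbrev interval (κ : ℝ) : Set ℝ := Icc (2 - κ) (scaledMap κ (2 - κ) + 1)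

theorem mapsTo_interval (h1 : 1 < κ) (hκ : κ < 2) :
    MapsTo (scaledMap κ) (interval κ) (interval κ) := fun x hx =>
  have hbound := isAbsorbingBound h1 hκ
  ⟨hbound.mapsTo hx.1, (le_total x (scaledMap κ (2 - κ))).elim
    (fun h => (hbound.apply_le x hx.1 h).trans (lt_add_one _).le)
    fun h => (lt_self (by linarith) ((inv_lt_apply_two_sub h1 hκ).trans_le h)).le.trans hx.2⟩

theorem interval_subset (hκ : κ < 2) : interval κ ⊆ Ioi 0 := fun _ hx =>
  (sub_pos.2 hκ).trans_le hx.1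

theorem continuous_restrict (hκ : κ < 2) (h : MapsTo (scaledMap κ) (interval κ) (interval κ)) :
    Continuous (h.restrict (scaledMap κ) _ _) :=
  (continuousOn.mono (interval_subset hκ)).mapsToRestrict h

theorem inClassG_restrict (h1 : 1 < κ) (hκ : κ < 2)
    (h : MapsTo (scaledMap κ) (interval κ) (interval κ)) :
    InClassG (h.restrict (scaledMap κ) _ _) := by
  have h0 : 0 < κ := one_pos.trans h1
  have hinv := inv_lt_apply_two_sub h1 hκ
  have hinv1 : κ⁻¹ < 1 := inv_lt_one_of_one_lt₀ h1
  have hl : 2 - κ < 1 := by linarith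
  have hr : 1 < scaledMap κ (2 - κ) + 1 := lt_add_of_pos_left 1 ((inv_pos.2 h0).trans hinv)
  refine ⟨continuous_restrict hκ h, (hl.trans hr).le, ⟨1, hl.le, hr.le⟩, hl, hr, ?_, ?_, ?_, ?_, ?_⟩
  · exact fun x hx y hy hxy => strictAntiOn ⟨interval_subset hκ x.2, hx⟩
      ⟨interval_subset hκ y.2, hy⟩ hxy
  · exact fun x hx y hy hxy => strictMonoOn (κ := κ) hx hy hxy
  · exact (two_sub_lt_inv h1).trans hinv
  · exact lt_self h0 (hinv.trans (lt_add_one _))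
  · exact fun x hx _ => lt_self (κ := κ) h0 (hinv1.trans_le hx)

theorem turbulent_restrict_iterate_two_iff (h1 : 1 < κ) (hκ : κ < 2)
    (h : MapsTo (scaledMap κ) (interval κ) (interval κ)) :
    Turbulent (h.restrict (scaledMap κ) _ _)^[2] ↔ 5 / 3 ≤ κ := by
  have hval : Semiconj Subtype.val (h.restrict (scaledMap κ) _ _) (scaledMap κ) := fun _ => rfl
  have htriple {x₁ x₂ x₃ : interval κ} :=
    isTurbulentTriple_map_iff (x₁ := x₁) (x₂ := x₂) (x₃ := x₃) (Subtype.strictMono_coe _)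
      (hval.iterate_right 2)
  rw [turbulent_iff_exists_isTurbulentTriple, and_iff_right ((continuous_restrict hκ h).iterate 2)]
  constructor
  · rintro ⟨x₁, x₂, x₃, hx⟩
    exact five_thirds_le_of_isTurbulentTriple h1 hκ x₁.2.1 x₂.2.1 x₃.2.1 (htriple.2 hx)
  · intro h53
    obtain ⟨x, hx, hturb⟩ := exists_isTurbulentTriple_iterate_two h53 hκ
    have htop : κ ≤ scaledMap κ (2 - κ) := (le_apply_two_sub_iff h1 hκ).2 h53
    have hsub : Icc κ⁻¹ κ ⊆ interval κ :=
      Icc_subset_Icc (two_sub_lt_inv h1).le (htop.trans (lt_add_one _).le)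
    have hinv : κ⁻¹ ≤ κ := (hx.1.le.trans hx.2).trans h1.le
    exact ⟨⟨κ⁻¹, hsub (left_mem_Icc.2 hinv)⟩, ⟨κ, hsub (right_mem_Icc.2 hinv)⟩,
      ⟨x, hsub ⟨hx.1.le, hx.2.trans h1.le⟩⟩, htriple.1 hturb⟩

theorem eq_inv_of_isPeriodicPt_odd {n : ℕ} (h1 : 1 < κ) (hκ : κ ≤ 5 / 3) (hx : 0 < x) (hn : Odd n)
    (hper : IsPeriodicPt (scaledMap κ) n x) : x = κ⁻¹ := by
  have hκ2 : κ < 2 := by linarith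
  have hbound := isAbsorbingBound h1 hκ2
  have hle : 2 - κ ≤ x := by
    obtain ⟨k, rfl⟩ := hn
    calc 2 - κ ≤ scaledMap κ ((scaledMap κ)^[2 * k] x) :=
          two_sub_le ((mapsTo_pos hκ2).iterate _ hx)
      _ = (scaledMap κ)^[2 * k + 1] x := (iterate_succ_apply' _ _ _).symm
      _ = x := hper.eq
  have hge : x ≤ scaledMap κ (2 - κ) := hbound.le_of_isPeriodicPt hle hn.pos hper
  have htop : scaledMap κ (2 - κ) ≤ κ :=
    not_lt.1 fun h => hκ.not_gt ((lt_apply_two_sub_iff h1 hκ2).1 h)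
  have hinter := mem_inter_of_isPeriodicPt_odd (mapsTo_Icc_two_sub_inv h1 hκ2)
    ((mapsTo_Icc_inv_self h1).mono_left (Icc_subset_Icc_right htop)) hn hper
    ((le_total x κ⁻¹).imp (fun h => ⟨hle, h⟩) fun h => ⟨h, hge⟩)
  exact hinter.1.2.antisymm hinter.2.1

theorem exists_isPeriodicPt_odd_of_five_thirds_lt (h1 : 5 / 3 < κ) (hκ : κ < 2) :
    ∃ p ∈ Ioc κ⁻¹ 1, ∃ n, Odd n ∧ IsPeriodicPt (scaledMap κ) n p := by
  have h1' : 1 < κ := by linarith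
  have hinv : 0 < κ⁻¹ := inv_pos.2 (by linarith)
  have h3 : κ⁻¹ < (scaledMap κ)^[3] 1 := by
    have hmono := strictMonoOn (κ := κ) h1'.le
      (h1'.trans ((lt_apply_two_sub_iff h1' hκ).2 h1)).le ((lt_apply_two_sub_iff h1' hκ).2 h1)
    rwa [apply_self, ← apply_one] at hmono
  refine exists_isPeriodicPt_odd continuousOn (mapsTo_pos hκ) (inv_lt_one_of_one_lt₀ h1')
    (fun x hx => hinv.trans_le hx.1) apply_inv (fun x => lt_iterate_two (by linarith) hκ) ?_ h3
  exact apply_one.trans_le (two_sub_lt_inv h1').le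

theorem hasOddPeriodCycle_iff (h1 : 1 < κ) (hκ : κ < 2) :
    HasOddPeriodCycle (Ioi 0) (scaledMap κ) ↔ 5 / 3 < κ := by
  rw [hasOddPeriodCycle_iff_exists_isPeriodicPt (mapsTo_pos hκ)]
  constructor
  · rintro ⟨p, hp, hne, n, hn, hper⟩
    by_contra! hle
    rw [eq_inv_of_isPeriodicPt_odd h1 hle hp hn hper] at hne
    exact hne apply_inv
  · intro h53
    obtain ⟨p, hp, hn⟩ := exists_isPeriodicPt_odd_of_five_thirds_lt h53 hκ
    have h0 : 0 < κ := one_pos.trans h1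
    exact ⟨p, (inv_pos.2 h0).trans hp.1, (lt_self h0 hp.1).ne, hn⟩

end scaledMap

/-! ### Rescaling by the critical price -/

section Rescaling

/-- The order isomorphism between closed intervals induced by an order automorphism `e` of the
line. The images of the endpoints are free so that they can be given in any form. -/
def iccOrderIso {a b c d : ℝ} (e : ℝ ≃o ℝ) (hac : e a = c) (hbd : e b = d) :
    Icc a b ≃o Icc c d where
  toEquiv := e.toEquiv.subtypeEquiv fun x => by
    simp [← hac, ← hbd]
  map_rel_iff' := e.map_rel_iff

/-- The parameter `κ` of the tâtonnement map when prices are measured in units of its critical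
price; in terms of it, the bounds on `λ` read `1 < κ < 2`. -/
noncomputable def scaledParameter (α β lam : ℝ) : ℝ := 4 * lam * (1 - α) / criticalPrice β lam

variable {α β lam t : ℝ}

theorem criticalPrice_pos (hβ : 0 < β) (hlam : 0 < lam) : 0 < criticalPrice β lam :=
  Real.sqrt_pos.2 (by positivity)

theorem criticalPrice_sq (hβ : 0 ≤ β) (hlam : 0 ≤ lam) : criticalPrice β lam ^ 2 = 2 * lam * β :=
  Real.sq_sqrt (by positivity)

theorem scaledParameter_nonneg (hα : α ≤ 1) (hlam : 0 ≤ lam) : 0 ≤ scaledParameter α β lam :=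
  div_nonneg (mul_nonneg (by positivity) (sub_nonneg.2 hα)) (Real.sqrt_nonneg _)

theorem scaledParameter_sq (hβ : 0 < β) (hlam : 0 < lam) :
    scaledParameter α β lam ^ 2 = 8 * (1 - α) ^ 2 * lam / β := by
  rw [scaledParameter, div_pow, criticalPrice_sq hβ.le hlam.le]
  field_simp
  ring

theorem lt_scaledParameter_iff (hα : α < 1) (hβ : 0 < β) (hlam : 0 < lam) (ht : 0 ≤ t) :
    t < scaledParameter α β lam ↔ t ^ 2 * β / (8 * (1 - α) ^ 2) < lam := by
  have hα' : 0 < 8 * (1 - α) ^ 2 := by have := sub_pos.2 hα; positivity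
  rw [← sq_lt_sq₀ ht (scaledParameter_nonneg hα.le hlam.le), scaledParameter_sq hβ hlam,
    lt_div_iff₀ hβ, div_lt_iff₀' hα']

theorem scaledParameter_lt_iff (hα : α < 1) (hβ : 0 < β) (hlam : 0 < lam) (ht : 0 ≤ t) :
    scaledParameter α β lam < t ↔ lam < t ^ 2 * β / (8 * (1 - α) ^ 2) := by
  have hα' : 0 < 8 * (1 - α) ^ 2 := by have := sub_pos.2 hα; positivity
  rw [← sq_lt_sq₀ (scaledParameter_nonneg hα.le hlam.le) ht, scaledParameter_sq hβ hlam,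
    div_lt_iff₀ hβ, lt_div_iff₀' hα']

theorem semiconj_scaledMap_tatonnement (hβ : 0 < β) (hlam : 0 < lam) :
    Semiconj (criticalPrice β lam * ·) (scaledMap (scaledParameter α β lam))
      (tatonnement α β lam) := by
  intro x
  have hs := criticalPrice_pos hβ hlam
  have hsq := criticalPrice_sq hβ.le hlam.le
  -- At `x = 0` both sides agree because `0⁻¹ = 0`, so the conjugacy holds on the whole line.
  rcases eq_or_ne x 0 with rfl | hx
  · simp only [scaledMap, scaledParameter, tatonnement, excessDemand, inv_zero, div_zero, mul_zero]
    field_simp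
    ring
  · unfold scaledMap scaledParameter tatonnement excessDemand
    field_simp
    linear_combination hsq

theorem tatonnement_criticalPrice_mul (hβ : 0 < β) (hlam : 0 < lam) (x : ℝ) :
    tatonnement α β lam (criticalPrice β lam * x) =
      criticalPrice β lam * scaledMap (scaledParameter α β lam) x :=
  ((semiconj_scaledMap_tatonnement hβ hlam).eq x).symm

theorem criticalPrice_mul_two_sub (hβ : 0 < β) (hlam : 0 < lam) :
    criticalPrice β lam * (2 - scaledParameter α β lam) =
      tatonnement α β lam (criticalPrice β lam) := by
  rw [← scaledMap.apply_one, ← tatonnement_criticalPrice_mul hβ hlam, mul_one]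

theorem criticalPrice_mul_apply_two_sub_add_one (hβ : 0 < β) (hlam : 0 < lam) :
    criticalPrice β lam *
        (scaledMap (scaledParameter α β lam) (2 - scaledParameter α β lam) + 1) =
      (tatonnement α β lam)^[2] (criticalPrice β lam) + criticalPrice β lam := by
  rw [mul_add, mul_one, ← tatonnement_criticalPrice_mul hβ hlam,
    criticalPrice_mul_two_sub hβ hlam]
  rfl

/-- Scaled prices in the scaled interval correspond to prices in `E`. -/
noncomputable def intervalOrderIso (α : ℝ) (hβ : 0 < β) (hlam : 0 < lam) :
    scaledMap.interval (scaledParameter α β lam) ≃o priceInterval α β lam :=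
  iccOrderIso (OrderIso.mulLeft₀ _ (criticalPrice_pos hβ hlam))
    (criticalPrice_mul_two_sub hβ hlam) (criticalPrice_mul_apply_two_sub_add_one hβ hlam)

theorem mapsTo_priceInterval (hβ : 0 < β) (hlam : 0 < lam) (h1 : 1 < scaledParameter α β lam)
    (h2 : scaledParameter α β lam < 2) :
    MapsTo (tatonnement α β lam) (priceInterval α β lam) (priceInterval α β lam) := by
  intro p hp
  obtain ⟨x, hx⟩ := (intervalOrderIso α hβ hlam).surjective ⟨p, hp⟩
  obtain rfl : criticalPrice β lam * x = p := congrArg Subtype.val hx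
  rw [tatonnement_criticalPrice_mul hβ hlam]
  exact (intervalOrderIso α hβ hlam ⟨_, scaledMap.mapsTo_interval h1 h2 x.2⟩).2

theorem semiconj_intervalOrderIso (hβ : 0 < β) (hlam : 0 < lam)
    (h : MapsTo (scaledMap (scaledParameter α β lam))
      (scaledMap.interval (scaledParameter α β lam)) (scaledMap.interval (scaledParameter α β lam)))
    (hE : MapsTo (tatonnement α β lam) (priceInterval α β lam) (priceInterval α β lam)) :
    Semiconj (intervalOrderIso α hβ hlam) (h.restrict _ _ _) (hE.restrict _ _ _) := fun x =>
  Subtype.ext (semiconj_scaledMap_tatonnement hβ hlam x)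

theorem hasOddPeriodCycle_tatonnement_iff (hβ : 0 < β) (hlam : 0 < lam)
    (h1 : 1 < scaledParameter α β lam) (h2 : scaledParameter α β lam < 2) :
    HasOddPeriodCycle (Ioi 0) (tatonnement α β lam) ↔ 5 / 3 < scaledParameter α β lam := by
  have hs := criticalPrice_pos hβ hlam
  have hpre : (OrderIso.mulLeft₀ _ hs).toEquiv ⁻¹' Ioi 0 = Ioi 0 :=
    ext fun x => mul_pos_iff_of_pos_left hs
  rw [hasOddPeriodCycle_iff_of_semiconj (OrderIso.mulLeft₀ _ hs).toEquiv
    (semiconj_scaledMap_tatonnement hβ hlam), hpre, scaledMap.hasOddPeriodCycle_iff h1 h2]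

end Rescaling

theorem theorem1_general (α β lam : ℝ) (hα : α < 1) (hβ : 0 < β)
    (hlow : β / (8 * (1 - α) ^ 2) < lam) (hupp : lam < β / (2 * (1 - α) ^ 2)) :
    (∃ hE : MapsTo (tatonnement α β lam) (priceInterval α β lam) (priceInterval α β lam),
      InClassG (hE.restrict (tatonnement α β lam) _ _) ∧
      (Turbulent ((hE.restrict (tatonnement α β lam) _ _)^[2]) ↔
        25 * β / (72 * (1 - α) ^ 2) ≤ lam ∧ lam < β / (2 * (1 - α) ^ 2))) ∧
    (HasOddPeriodCycle (Ioi 0) (tatonnement α β lam) ↔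
      25 * β / (72 * (1 - α) ^ 2) < lam ∧ lam < β / (2 * (1 - α) ^ 2)) := by
  have hlam : 0 < lam := hlow.trans_le' (by positivity)
  have hα' : 1 - α ≠ 0 := (sub_pos.2 hα).ne'
  have h1 : 1 < scaledParameter α β lam := by
    rw [lt_scaledParameter_iff hα hβ hlam one_pos.le]
    simpa only [one_pow, one_mul] using hlow
  have h2 : scaledParameter α β lam < 2 := by
    rw [scaledParameter_lt_iff hα hβ hlam two_pos.le]
    convert hupp using 1
    field_simp
    norm_num
  have h53 : (5 / 3) ^ 2 * β / (8 * (1 - α) ^ 2) = 25 * β / (72 * (1 - α) ^ 2) := by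
    field_simp
    norm_num
  have hmap := scaledMap.mapsTo_interval h1 h2
  have hE := mapsTo_priceInterval hβ hlam h1 h2
  have hconj := semiconj_intervalOrderIso hβ hlam hmap hE
  rw [and_iff_left hupp, and_iff_left hupp, hasOddPeriodCycle_tatonnement_iff hβ hlam h1 h2,
    lt_scaledParameter_iff hα hβ hlam (by norm_num), h53]
  refine ⟨⟨hE, (scaledMap.inClassG_restrict h1 h2 hmap).of_semiconj _ hconj, ?_⟩, Iff.rfl⟩
  rw [turbulent_iterate_iff_of_semiconj _ hconj,
    scaledMap.turbulent_restrict_iterate_two_iff h1 h2, ← not_lt,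
    scaledParameter_lt_iff hα hβ hlam (by norm_num), h53, not_lt]

theorem theorem1 (α β lam : ℝ) (hα : α ∈ Set.Ioo (0 : ℝ) 1) (hβ : β ∈ Set.Ioo (0 : ℝ) 1)
    (hlam : 0 < lam)
    (hlow : β / (8 * (1 - α) ^ 2) < lam) (hupp : lam < β / (2 * (1 - α) ^ 2)) :
    (∃ hE : Set.MapsTo (tatonnement α β lam) (priceInterval α β lam) (priceInterval α β lam),
      InClassG (hE.restrict (tatonnement α β lam) _ _) ∧
      (Turbulent ((hE.restrict (tatonnement α β lam) _ _)^[2]) ↔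
        25 * β / (72 * (1 - α) ^ 2) ≤ lam ∧ lam < β / (2 * (1 - α) ^ 2))) ∧
    (HasOddPeriodCycle (Set.Ioi 0) (tatonnement α β lam) ↔
      25 * β / (72 * (1 - α) ^ 2) < lam ∧ lam < β / (2 * (1 - α) ^ 2)) :=
  theorem1_general α β lam hα.2 hβ.1 hlow hupp
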